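/- Let $n\ge 1$ be an integer and let $p,q,s$ be real numbers with $1\le q<p<\infty$, $s\ge 0$ and $s>n\left(\tfrac12-\tfrac1p\right)$. For a measurable $f:\mathbb R^n\to\mathbb C$ put $$\|f\|_{L^{q,\infty}}=\sup_{\gamma>0}\gamma\,\bigl|\{x:|f(x)|>\gamma\}\bigr|^{1/q},$$ and let $L^{q,\infty}(\mathbb R^n)$ be the set of those $f$ for which this is finite. Let $\dot H^s(\mathbb R^n)$ be the set of tempered distributions $f$ whose Fourier transform $\hat f$ (with kernel $e^{-2\pi i\xi\cdot x}$) is a locally integrable function with $$\|f\|_{\dot H^s}=\left(\int_{\mathbb R^n}|\xi|^{2s}|\hat f(\xi)|^2\,d\xi\right)^{1/2}<\infty .$$ Then there is a real $\theta\in(0,1)$ with $$\frac1p=\frac{\theta}{q}+(1-\theta)\left(\frac12-\frac sn\right),$$ and there is a constant $c$, depending only on $n,p,q,s$, such that every $f\in L^{q,\infty}(\mathbb R^n)\cap\dot H^s(\mathbb R^n)$ (that is, every locally integrable function $f\in L^{q,\infty}(\mathbb R^n)$ whose associated distribution is tempered and belongs to $\dot H^s(\mathbb R^n)$) lies in $L^p(\mathbb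 R^n)$ and satisfies $$\|f\|_{L^p}\le c\,\|f\|_{L^{q,\infty}}^{\theta}\,\|f\|_{\dot H^s}^{1-\theta}.$$ In particular (the case $n=q=2$, $p=4$, $s=1$), there is a constant $c$ such that every $f\in L^{2,\infty}(\mathbb R^2)\cap\dot H^1(\mathbb R^2)$ lies in $L^4(\mathbb R^2)$ and satisfies $$\|f\|_{L^4}\le c\,\|f\|_{L^{2,\infty}}^{1/2}\,\|f\|_{\dot H^1}^{1/2}.$$ -/

import Mathlib

open MeasureTheory SchwartzMap FourierTransform
open scoped ENNReal NNReal

namespace GagliardoNirenberg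

/-- The distribution function `d_f(α) = |{x : |f(x)| > α}|` with respect to Lebesgue measure. -/
noncomputable def distributionFunction {n : ℕ} (f : EuclideanSpace ℝ (Fin n) → ℂ) (α : ℝ) :
    ℝ≥0∞ :=
  volume {x | α < ‖f x‖}

/-- The weak `L^q` quasinorm `sup {γ d_f(γ)^{1/q} : γ > 0}`, with values in `[0, ∞]`. -/
noncomputable def weakLpNorm {n : ℕ} (f : EuclideanSpace ℝ (Fin n) → ℂ) (q : ℝ) : ℝ≥0∞ :=
  ⨆ (γ : ℝ) (_ : 0 < γ), ENNReal.ofReal γ * distributionFunction f γ ^ (1 / q)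

/-- Membership in the weak Lebesgue space `L^{q,∞}(ℝⁿ)`. -/
def MemWeakLp {n : ℕ} (f : EuclideanSpace ℝ (Fin n) → ℂ) (q : ℝ) : Prop :=
  AEStronglyMeasurable f volume ∧ weakLpNorm f q < ∞

/-- The tempered distribution `T` is (given by) the locally integrable function `f`:
`T φ = ∫ φ f` for all compactly supported smooth `φ`.  As these `φ` are dense in the Schwartz
space, `T` is determined by `f`; conversely `f` is determined by `T` almost everywhere. -/
def IsGivenBy {n : ℕ} (T : 𝓢'(EuclideanSpace ℝ (Fin n), ℂ))
    (f : EuclideanSpace ℝ (Fin n) → ℂ) : Prop :=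
  LocallyIntegrable f volume ∧
    ∀ φ : 𝓢(EuclideanSpace ℝ (Fin n), ℂ), HasCompactSupport φ → T φ = ∫ x, φ x • f x

/-- `(∫ |ξ|^{2s} |g(ξ)|² dξ)^{1/2}`, with values in `[0, ∞]`. -/
noncomputable def weightedL2Norm {n : ℕ} (s : ℝ) (g : EuclideanSpace ℝ (Fin n) → ℂ) : ℝ≥0∞ :=
  (∫⁻ ξ, ENNReal.ofReal (‖ξ‖ ^ (2 * s) * ‖g ξ‖ ^ 2)) ^ (1 / 2 : ℝ)

/-- Membership in the homogeneous Sobolev space `Ḣ^s(ℝⁿ)`: the Fourier transform of the tempered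
distribution `T` is a locally integrable function `g`, and `∫ |ξ|^{2s} |g(ξ)|² dξ < ∞`.
(Mathlib's Fourier transform has the kernel `exp(-2πi ξ·x)`.) -/
def MemHomSobolev {n : ℕ} (s : ℝ) (T : 𝓢'(EuclideanSpace ℝ (Fin n), ℂ)) : Prop :=
  ∃ g : EuclideanSpace ℝ (Fin n) → ℂ, IsGivenBy (𝓕 T) g ∧ weightedL2Norm s g < ∞

/-- The norm of `Ḣ^s(ℝⁿ)`.  The functions `g` over which the infimum is taken are all equal almost
everywhere, so this is `(∫ |ξ|^{2s} |g(ξ)|² dξ)^{1/2}` for any one of them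
(`homSobolevNorm_eq`), and `∞` if the Fourier transform is not a locally integrable function. -/
noncomputable def homSobolevNorm {n : ℕ} (s : ℝ) (T : 𝓢'(EuclideanSpace ℝ (Fin n), ℂ)) : ℝ≥0∞ :=
  ⨅ (g : EuclideanSpace ℝ (Fin n) → ℂ) (_ : IsGivenBy (𝓕 T) g), weightedL2Norm s g

theorem IsGivenBy.ae_eq {n : ℕ} {T : 𝓢'(EuclideanSpace ℝ (Fin n), ℂ)}
    {f g : EuclideanSpace ℝ (Fin n) → ℂ} (hf : IsGivenBy T f) (hg : IsGivenBy T g) :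
    f =ᵐ[volume] g := by
  refine ae_eq_of_integral_contDiff_smul_eq hf.1 hg.1 fun u hu hc => ?_
  have h₁ : HasCompactSupport (Complex.ofRealCLM ∘ u) := hc.comp_left rfl
  have h₂ : ContDiff ℝ ((⊤ : ℕ∞) : WithTop ℕ∞) (Complex.ofRealCLM ∘ u) := by fun_prop
  have e := (hf.2 (h₁.toSchwartzMap h₂) h₁).symm.trans
    (hg.2 (h₁.toSchwartzMap h₂) h₁)
  simpa using e

theorem homSobolevNorm_eq {n : ℕ} (s : ℝ) {T : 𝓢'(EuclideanSpace ℝ (Fin n), ℂ)}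
    {g : EuclideanSpace ℝ (Fin n) → ℂ} (hg : IsGivenBy (𝓕 T) g) :
    homSobolevNorm s T = weightedL2Norm s g := by
  refine le_antisymm (iInf₂_le g hg) (le_iInf₂ fun h hh => le_of_eq ?_)
  unfold weightedL2Norm
  congr 1
  refine lintegral_congr_ae ?_
  filter_upwards [hg.ae_eq hh] with x hx
  rw [hx]

end GagliardoNirenberg

/-!
The proof splits `f` at a frequency `R` into a low-frequency part, bounded in `L^∞`, and a
high-frequency part, bounded in `L²` by `R ^ (-s) ‖f‖_{Ḣ^s}` (Plancherel).  If `R` is such that the low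
part is at most `α / 2`, then `{‖f‖ > α}` is contained in the set where the high part exceeds `α / 2`,
and Chebyshev's inequality bounds the distribution function by
`4 α ^ (-2) R ^ (-2s) ‖f‖_{Ḣ^s}²` (`distributionFunction_le_of_norm_lowPart_le`).

For the size of the low part one uses Bernstein's inequality with the very norm to be estimated,
`‖low part‖_∞ ≤ C R ^ (n / p) ‖f‖_p` (`exists_norm_lowPart_le`).  As `p > 1`, this is just Hölder's
inequality, and it works uniformly down to `q = 1`, where convolution with a Schwartz function is not
bounded from weak `L^1` to `L^∞`.  The optimal `R` gives a distribution function
`O(α ^ (-r) ‖f‖_p ^ (r - 2) ‖f‖_{Ḣ^s}²)` with `r = 2 + 2 s p / n`, and the hypothesis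
`s > n (1 / 2 - 1 / p)` says exactly that `r > p`.  In the layer cake formula for `‖f‖_p ^ p` the weak
`L^q` bound is used below a height `α₀` and the new bound above it
(`lintegral_rpow_norm_le_of_distributionFunction_le`).  For a suitable `α₀` the first contribution is
half of `‖f‖_p ^ p` and is absorbed (`rpow_le_of_layer_cake_bound`); what is left is the inequality.

Absorption needs `‖f‖_p < ∞` beforehand.  This is `memLp_of_weakLpNorm_lt_top`, by the same
splitting, with the low part bounded by the `L¹` norm of the Fourier transform over a ball.  Here the
local integrability of the Fourier transform near the origin is essential.
-/


namespace GagliardoNirenberg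

open Filter Topology Pointwise

variable {n : ℕ}

/-! ### Smooth cutoffs and density of compactly supported test functions -/

/-- A smooth bump on `ℝⁿ`, equal to `1` on the closed unit ball and to `0` off the ball of
radius `2`. -/
noncomputable def unitBump (n : ℕ) : ContDiffBump (0 : EuclideanSpace ℝ (Fin n)) :=
  ⟨1, 2, one_pos, one_lt_two⟩

/-- The smooth cutoff at radius `R`: the unit bump dilated by `R`, equal to `1` on `‖x‖ ≤ R` and to
`0` on `‖x‖ ≥ 2R`.  It is complex valued, so that it can serve as a Schwartz multiplier. -/
noncomputable def cutoff (R : ℝ) (x : EuclideanSpace ℝ (Fin n)) : ℂ :=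
  (unitBump n (R⁻¹ • x) : ℝ)

theorem contDiff_cutoff (R : ℝ) :
    ContDiff ℝ ((⊤ : ℕ∞) : WithTop ℕ∞) (cutoff R : EuclideanSpace ℝ (Fin n) → ℂ) := by
  have h : ContDiff ℝ ((⊤ : ℕ∞) : WithTop ℕ∞)
      (fun x : EuclideanSpace ℝ (Fin n) => unitBump n (R⁻¹ • x)) :=
    (unitBump n).contDiff.comp (contDiff_const_smul R⁻¹)
  exact Complex.ofRealCLM.contDiff.comp h

theorem cutoff_eq_one {R : ℝ} (hR : 0 < R) {x : EuclideanSpace ℝ (Fin n)} (hx : ‖x‖ ≤ R) :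
    cutoff R x = 1 := by
  have : unitBump n (R⁻¹ • x) = 1 := by
    apply (unitBump n).one_of_mem_closedBall
    simp only [Metric.mem_closedBall, dist_zero_right, norm_smul, norm_inv, Real.norm_eq_abs,
      abs_of_pos hR, unitBump]
    rw [inv_mul_le_iff₀ hR]; simpa using hx
  simp [cutoff, this]

theorem cutoff_eq_zero {R : ℝ} (hR : 0 < R) {x : EuclideanSpace ℝ (Fin n)} (hx : 2 * R ≤ ‖x‖) :
    cutoff R x = 0 := by
  have : unitBump n (R⁻¹ • x) = 0 := by
    apply (unitBump n).zero_of_le_dist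
    simp only [dist_zero_right, norm_smul, norm_inv, Real.norm_eq_abs,
      abs_of_pos hR, unitBump]
    rw [le_inv_mul_iff₀ hR]; linarith
  simp [cutoff, this]

theorem norm_cutoff_le (R : ℝ) (x : EuclideanSpace ℝ (Fin n)) : ‖cutoff R x‖ ≤ 1 := by
  simp only [cutoff, Complex.norm_real, Real.norm_eq_abs, abs_of_nonneg (unitBump n).nonneg]
  exact (unitBump n).le_one

theorem norm_one_sub_cutoff_le (R : ℝ) (x : EuclideanSpace ℝ (Fin n)) :
    ‖1 - cutoff R x‖ ≤ 1 := by
  rw [cutoff, ← Complex.ofReal_one, ← Complex.ofReal_sub, Complex.norm_real, Real.norm_eq_abs,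
    abs_of_nonneg (sub_nonneg.2 (unitBump n).le_one)]
  linarith [(unitBump n).nonneg (x := R⁻¹ • x)]

theorem hasCompactSupport_cutoff {R : ℝ} (hR : 0 < R) :
    HasCompactSupport (cutoff R : EuclideanSpace ℝ (Fin n) → ℂ) := by
  refine HasCompactSupport.intro (isCompact_closedBall 0 (2 * R)) fun x hx => ?_
  refine cutoff_eq_zero hR ?_
  simp at hx
  exact hx.le

theorem hasTemperateGrowth_cutoff {R : ℝ} (hR : 0 < R) :
    (cutoff R : EuclideanSpace ℝ (Fin n) → ℂ).HasTemperateGrowth :=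
  (hasCompactSupport_cutoff hR).hasTemperateGrowth (contDiff_cutoff R)

theorem one_sub_cutoff_eq (R : ℝ) :
    (fun x : EuclideanSpace ℝ (Fin n) => 1 - cutoff R x) =
      fun x => (fun y => 1 - cutoff 1 y) (R⁻¹ • x) := by
  funext x; simp [cutoff]

/-- The derivatives of `1 - cutoff R` are bounded uniformly in `R ≥ 1`, since they arise from those
of `1 - cutoff 1` by a dilation that only decreases them. -/
theorem exists_bound_iteratedFDeriv_one_sub_cutoff (n i : ℕ) :
    ∃ C : ℝ, 0 ≤ C ∧ ∀ R : ℝ, 1 ≤ R → ∀ x : EuclideanSpace ℝ (Fin n),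
      ‖iteratedFDeriv ℝ i (fun y => 1 - cutoff R y) x‖ ≤ C := by
  have hc : ContDiff ℝ ((⊤ : ℕ∞) : WithTop ℕ∞)
      (fun y : EuclideanSpace ℝ (Fin n) => 1 - cutoff 1 y) :=
    contDiff_const.sub (contDiff_cutoff 1)
  obtain ⟨C, hC⟩ : ∃ C : ℝ, ∀ x : EuclideanSpace ℝ (Fin n),
      ‖iteratedFDeriv ℝ i (fun y => 1 - cutoff 1 y) x‖ ≤ C := by
    have hcont : Continuous (iteratedFDeriv ℝ i
        (fun y : EuclideanSpace ℝ (Fin n) => 1 - cutoff 1 y)) :=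
      hc.continuous_iteratedFDeriv (by exact_mod_cast le_top)
    obtain ⟨C, hC⟩ := (isCompact_closedBall
      (0 : EuclideanSpace ℝ (Fin n)) 3).exists_bound_of_continuousOn hcont.continuousOn
    refine ⟨max C 1, fun x => ?_⟩
    by_cases hx : ‖x‖ ≤ 3
    · exact (hC x (by simpa using hx)).trans (le_max_left _ _)
    · have he : (fun y : EuclideanSpace ℝ (Fin n) => 1 - cutoff 1 y) =ᶠ[𝓝 x] fun _ => (1 : ℂ) := by
        have : {y : EuclideanSpace ℝ (Fin n) | 2 < ‖y‖} ∈ 𝓝 x :=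
          (isOpen_lt continuous_const continuous_norm).mem_nhds (by simp; linarith)
        filter_upwards [this] with y hy
        rw [cutoff_eq_zero one_pos (by simpa using hy.le), sub_zero]
      rw [he.iteratedFDeriv ℝ i |>.eq_of_nhds]
      refine le_trans ?_ (le_max_right _ _)
      rcases Nat.eq_zero_or_pos i with rfl | hi
      · simp
      · rw [iteratedFDeriv_const_of_ne hi.ne']; simp
  refine ⟨C, (norm_nonneg _).trans (hC 0), fun R hR x => ?_⟩
  rw [one_sub_cutoff_eq, iteratedFDeriv_comp_const_smul _ (hc.of_le (by exact_mod_cast le_top)),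
    norm_smul, norm_pow, norm_inv, Real.norm_eq_abs, abs_of_pos (one_pos.trans_le hR)]
  calc _ ≤ 1 * C := mul_le_mul (pow_le_one₀ (by positivity) (inv_le_one_of_one_le₀ hR)) (hC _)
        (norm_nonneg _) zero_le_one
    _ = C := one_mul C

/-- Truncations of a Schwartz function converge to it in the Schwartz topology.  The difference lives
on `‖x‖ ≥ R`, where one extra power of `‖x‖` in the seminorm buys a factor `1 / R`. -/
theorem tendsto_smulLeftCLM_cutoff (ψ : 𝓢(EuclideanSpace ℝ (Fin n), ℂ)) :
    Tendsto (fun k : ℕ => smulLeftCLM ℂ (cutoff ((k : ℝ) + 1)) ψ) atTop (𝓝 ψ) := by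
  rw [(schwartz_withSeminorms ℂ (EuclideanSpace ℝ (Fin n)) ℂ).tendsto_nhds]
  rintro ⟨k, m⟩ ε hε
  choose C hC0 hC using exists_bound_iteratedFDeriv_one_sub_cutoff n
  set K : ℝ := ∑ i ∈ Finset.range (m + 1), (m.choose i : ℝ) * C i *
    SchwartzMap.seminorm ℂ (k + 1) (m - i) ψ with hK
  have hK0 : 0 ≤ K := Finset.sum_nonneg fun i _ => by
    have := hC0 i
    have := apply_nonneg (SchwartzMap.seminorm ℂ (k + 1) (m - i)) ψ
    positivity
  have hb : ∀ j : ℕ, SchwartzMap.seminorm ℂ k m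
      (smulLeftCLM ℂ (cutoff ((j : ℝ) + 1)) ψ - ψ) ≤ K / ((j : ℝ) + 1) := by
    intro j
    have hR : (0 : ℝ) < (j : ℝ) + 1 := by positivity
    have hR1 : (1 : ℝ) ≤ (j : ℝ) + 1 := by simp
    refine SchwartzMap.seminorm_le_bound ℂ k m _ (by positivity) fun x => ?_
    have hfun : ((smulLeftCLM ℂ (cutoff ((j : ℝ) + 1)) ψ - ψ : 𝓢(EuclideanSpace ℝ (Fin n), ℂ)) :
        EuclideanSpace ℝ (Fin n) → ℂ) = fun y => (-1 : ℝ) • ((1 - cutoff ((j : ℝ) + 1) y) • ψ y) := by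
      funext y
      simp [smulLeftCLM_apply_apply (hasTemperateGrowth_cutoff hR)]
      ring
    have hcu : ContDiff ℝ ((⊤ : ℕ∞) : WithTop ℕ∞)
        (fun y : EuclideanSpace ℝ (Fin n) => 1 - cutoff ((j : ℝ) + 1) y) :=
      contDiff_const.sub (contDiff_cutoff _)
    rw [hfun]
    by_cases hx : ‖x‖ < (j : ℝ) + 1
    · have he : (fun y : EuclideanSpace ℝ (Fin n) =>
          (-1 : ℝ) • ((1 - cutoff ((j : ℝ) + 1) y) • ψ y)) =ᶠ[𝓝 x] fun _ => (0 : ℂ) := by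
        have : {y : EuclideanSpace ℝ (Fin n) | ‖y‖ < (j : ℝ) + 1} ∈ 𝓝 x :=
          (isOpen_lt continuous_norm continuous_const).mem_nhds hx
        filter_upwards [this] with y hy
        rw [cutoff_eq_one hR (le_of_lt hy)]; simp
      rw [he.iteratedFDeriv ℝ m |>.eq_of_nhds]
      have : iteratedFDeriv ℝ m (fun _ : EuclideanSpace ℝ (Fin n) => (0 : ℂ)) x = 0 := by
        simp
      rw [this]; simp; positivity
    · push Not at hx
      have hsm : ContDiff ℝ ((⊤ : ℕ∞) : WithTop ℕ∞)
        (fun y => (1 - cutoff ((j : ℝ) + 1) y) • ψ y) := hcu.smul (ψ.smooth ⊤)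
      rw [iteratedFDeriv_const_smul_apply' (hsm.contDiffAt.of_le (by exact_mod_cast le_top)),
        norm_smul]
      have hL := norm_iteratedFDeriv_smul_le (𝕜 := ℝ)
        (hcu.of_le (m := (m : ℕ∞)) (by exact_mod_cast le_top))
        (ψ.smooth m) x (n := m) (by simp)
      rw [le_div_iff₀ hR]
      calc ‖x‖ ^ k * (‖(-1 : ℝ)‖ * ‖iteratedFDeriv ℝ m
              (fun y => (1 - cutoff ((j : ℝ) + 1) y) • ψ y) x‖) * ((j : ℝ) + 1)
          ≤ ‖x‖ ^ k * (1 * ∑ i ∈ Finset.range (m + 1), (m.choose i : ℝ) *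
              ‖iteratedFDeriv ℝ i (fun y => 1 - cutoff ((j : ℝ) + 1) y) x‖ *
              ‖iteratedFDeriv ℝ (m - i) ψ x‖) * ‖x‖ := by
            gcongr
            simp
        _ = ∑ i ∈ Finset.range (m + 1), (m.choose i : ℝ) *
              ‖iteratedFDeriv ℝ i (fun y => 1 - cutoff ((j : ℝ) + 1) y) x‖ *
              (‖x‖ ^ (k + 1) * ‖iteratedFDeriv ℝ (m - i) ψ x‖) := by
            rw [one_mul, Finset.mul_sum, Finset.sum_mul]
            exact Finset.sum_congr rfl fun i _ => by ring
        _ ≤ K := by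
            refine Finset.sum_le_sum fun i _ => ?_
            have := hC0 i
            gcongr
            · exact hC i _ hR1 x
            · exact SchwartzMap.le_seminorm ℂ _ _ ψ x
  obtain ⟨N, hN⟩ := exists_nat_gt (K / ε)
  filter_upwards [eventually_ge_atTop N] with j hj
  refine lt_of_le_of_lt (hb j) ?_
  have hR : (0 : ℝ) < (j : ℝ) + 1 := by positivity
  rw [div_lt_iff₀ hR]
  rw [div_lt_iff₀ hε] at hN
  have : (N : ℝ) ≤ j := by exact_mod_cast hj
  nlinarith

/-- A tempered distribution given by `f` on compactly supported test functions is also given by `f`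
on every Schwartz function `ψ` for which `ψ f` is integrable. -/
theorem IsGivenBy.apply_eq_integral {T : 𝓢'(EuclideanSpace ℝ (Fin n), ℂ)}
    {f : EuclideanSpace ℝ (Fin n) → ℂ} (hf : IsGivenBy T f)
    (ψ : 𝓢(EuclideanSpace ℝ (Fin n), ℂ)) (hψ : Integrable (fun x => ψ x • f x) volume) :
    T ψ = ∫ x, ψ x • f x := by
  have h1 : Tendsto (fun k : ℕ => T (smulLeftCLM ℂ (cutoff ((k : ℝ) + 1)) ψ)) atTop (𝓝 (T ψ)) :=
    (map_continuous T).continuousAt.tendsto.comp (tendsto_smulLeftCLM_cutoff ψ)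
  have h2 : Tendsto (fun k : ℕ => ∫ x, cutoff ((k : ℝ) + 1) x • (ψ x • f x)) atTop
      (𝓝 (∫ x, ψ x • f x)) := by
    refine tendsto_integral_of_dominated_convergence (fun x => ‖ψ x • f x‖) (fun k => ?_)
      hψ.norm (fun k => ?_) ?_
    · exact (contDiff_cutoff _).continuous.aestronglyMeasurable.smul hψ.aestronglyMeasurable
    · refine Eventually.of_forall fun x => ?_
      rw [norm_smul]
      exact mul_le_of_le_one_left (norm_nonneg _) (norm_cutoff_le _ _)
    · refine Eventually.of_forall fun x => tendsto_const_nhds.congr' ?_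
      obtain ⟨N, hN⟩ := exists_nat_ge ‖x‖
      filter_upwards [eventually_ge_atTop N] with k hk
      have : (N : ℝ) ≤ k := by exact_mod_cast hk
      rw [cutoff_eq_one (by positivity) (by linarith), one_smul]
  refine tendsto_nhds_unique h1 (h2.congr fun k => ?_)
  have hk : (0 : ℝ) < (k : ℝ) + 1 := by positivity
  have happ := smulLeftCLM_apply (F := ℂ) (hasTemperateGrowth_cutoff (n := n) hk) ψ
  rw [hf.2 _ (by rw [happ]; exact (hasCompactSupport_cutoff hk).smul_right)]
  refine integral_congr_ae (Eventually.of_forall fun x => ?_)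
  simp [happ, mul_assoc]

/-! ### Splitting into low and high frequencies -/

/-- The low-frequency part, at frequency `R`, of the function with Fourier transform `g`: the inverse
Fourier transform of the smoothly truncated `g`.  For locally integrable `g` the integral converges
absolutely, so this is an honest continuous function. -/
noncomputable def lowPart (R : ℝ) (g : EuclideanSpace ℝ (Fin n) → ℂ) :
    EuclideanSpace ℝ (Fin n) → ℂ :=
  𝓕⁻ (fun ξ => cutoff R ξ • g ξ)

theorem integrable_cutoff_smul {R : ℝ} (hR : 0 < R) {g : EuclideanSpace ℝ (Fin n) → ℂ}
    (hg : LocallyIntegrable g volume) : Integrable (fun ξ => cutoff R ξ • g ξ) volume :=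
  hg.integrable_smul_left_of_hasCompactSupport (contDiff_cutoff R).continuous
    (hasCompactSupport_cutoff hR)

theorem norm_lowPart_le {R : ℝ} (hR : 0 < R) {g : EuclideanSpace ℝ (Fin n) → ℂ}
    (hg : LocallyIntegrable g volume) (x : EuclideanSpace ℝ (Fin n)) :
    ‖lowPart R g x‖ ≤ ∫ ξ in Metric.closedBall 0 (2 * R), ‖g ξ‖ := by
  have h1 : ‖lowPart R g x‖ ≤ ∫ ξ, ‖cutoff R ξ • g ξ‖ := by
    rw [lowPart, Real.fourierInv_eq]
    exact (norm_integral_le_integral_norm _).trans_eq (by simp)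
  refine h1.trans ?_
  rw [← integral_indicator Metric.isClosed_closedBall.measurableSet]
  refine integral_mono_of_nonneg (Eventually.of_forall fun _ => norm_nonneg _) ?_
    (Eventually.of_forall fun ξ => ?_)
  · exact (integrable_indicator_iff Metric.isClosed_closedBall.measurableSet).2
      (hg.integrableOn_isCompact (isCompact_closedBall _ _)).norm
  · dsimp only
    by_cases hξ : ξ ∈ Metric.closedBall (0 : EuclideanSpace ℝ (Fin n)) (2 * R)
    · rw [Set.indicator_of_mem hξ, norm_smul]
      exact mul_le_of_le_one_left (norm_nonneg _) (norm_cutoff_le _ _)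
    · rw [Set.indicator_of_notMem hξ, cutoff_eq_zero hR (by simp at hξ; exact hξ.le)]
      simp

theorem continuous_lowPart {R : ℝ} (hR : 0 < R) {g : EuclideanSpace ℝ (Fin n) → ℂ}
    (hg : LocallyIntegrable g volume) : Continuous (lowPart R g) := by
  have hL : Continuous fun p : EuclideanSpace ℝ (Fin n) × EuclideanSpace ℝ (Fin n) =>
      (-innerₗ (EuclideanSpace ℝ (Fin n))) p.1 p.2 := continuous_inner.neg
  exact VectorFourier.fourierIntegral_continuous Real.continuous_fourierChar hL
    (integrable_cutoff_smul hR hg)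

theorem integral_smul_fourierInv (φ : 𝓢(EuclideanSpace ℝ (Fin n), ℂ))
    {F : EuclideanSpace ℝ (Fin n) → ℂ} (hF : Integrable F volume) :
    ∫ x, φ x • (𝓕⁻ F) x = ∫ ξ, (𝓕⁻ φ) ξ • F ξ := by
  have hL : Continuous fun p : EuclideanSpace ℝ (Fin n) × EuclideanSpace ℝ (Fin n) =>
      (-innerₗ (EuclideanSpace ℝ (Fin n))) p.1 p.2 := continuous_inner.neg
  have h := VectorFourier.integral_fourierIntegral_smul_eq_flip
    (L := -innerₗ (EuclideanSpace ℝ (Fin n))) Real.continuous_fourierChar hL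
    (φ.integrable (μ := volume)) hF
  have hflip : (-innerₗ (EuclideanSpace ℝ (Fin n))).flip = -innerₗ (EuclideanSpace ℝ (Fin n)) := by
    ext x y; simp [real_inner_comm]
  rw [hflip] at h
  rw [SchwartzMap.fourierInv_coe]
  exact h.symm

/-- The high frequencies are controlled in `L²` by the homogeneous Sobolev norm, because
`R ^ (-2s) ‖ξ‖ ^ (2s) ≥ 1` wherever `1 - cutoff R` does not vanish. -/
theorem eLpNorm_one_sub_cutoff_smul_le {R s : ℝ} (hR : 0 < R) (hs : 0 ≤ s)
    (g : EuclideanSpace ℝ (Fin n) → ℂ) :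
    eLpNorm (fun ξ => (1 - cutoff R ξ) • g ξ) 2 volume ≤
      ENNReal.ofReal (R ^ (-s)) * weightedL2Norm s g := by
  rw [eLpNorm_eq_lintegral_rpow_enorm_toReal two_ne_zero ENNReal.ofNat_ne_top, weightedL2Norm]
  have hpt : ∀ ξ : EuclideanSpace ℝ (Fin n), ‖(1 - cutoff R ξ) • g ξ‖ₑ ^ (2 : ℝ≥0∞).toReal ≤
      ENNReal.ofReal (R ^ (-s)) ^ (2 : ℝ) * ENNReal.ofReal (‖ξ‖ ^ (2 * s) * ‖g ξ‖ ^ 2) := by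
    intro ξ
    rw [← ofReal_norm, ENNReal.toReal_ofNat,
      ENNReal.ofReal_rpow_of_nonneg (norm_nonneg _) zero_le_two,
      ENNReal.ofReal_rpow_of_nonneg (by positivity) zero_le_two,
      ← ENNReal.ofReal_mul (by positivity)]
    refine ENNReal.ofReal_le_ofReal ?_
    by_cases hξ : ‖ξ‖ ≤ R
    · rw [cutoff_eq_one hR hξ]; simp; positivity
    · push Not at hξ
      rw [norm_smul, Real.rpow_two, mul_pow, ← mul_assoc, ← Real.rpow_mul hR.le]
      refine mul_le_mul_of_nonneg_right ?_ (by positivity)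
      calc ‖1 - cutoff R ξ‖ ^ 2 ≤ 1 := pow_le_one₀ (norm_nonneg _) (norm_one_sub_cutoff_le _ _)
        _ = R ^ (-s * 2) * R ^ (2 * s) := by
          rw [← Real.rpow_add hR]; ring_nf; simp
        _ ≤ R ^ (-s * 2) * ‖ξ‖ ^ (2 * s) := by gcongr
  calc _ ≤ (∫⁻ ξ, ENNReal.ofReal (R ^ (-s)) ^ (2 : ℝ) *
        ENNReal.ofReal (‖ξ‖ ^ (2 * s) * ‖g ξ‖ ^ 2)) ^ (1 / (2 : ℝ≥0∞).toReal) := by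
        gcongr with ξ; exact hpt ξ
    _ = _ := by
      rw [lintegral_const_mul' _ _ (by simp), ENNReal.mul_rpow_of_nonneg _ _ (by simp),
        ← ENNReal.rpow_mul]
      simp

/-- `f` is the sum of its low-frequency part and an `L²` function, whose norm is controlled by
Plancherel's theorem. The `L²` function is the inverse Fourier transform of the rest of `g`; the sum
agrees with `f` because both represent the distribution `T`. -/
theorem exists_eq_lowPart_add {T : 𝓢'(EuclideanSpace ℝ (Fin n), ℂ)}
    {f g : EuclideanSpace ℝ (Fin n) → ℂ} (hf : IsGivenBy T f) (hg : IsGivenBy (𝓕 T) g)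
    {s R : ℝ} (hs : 0 ≤ s) (hH : weightedL2Norm s g < ∞) (hR : 0 < R) :
    ∃ h : EuclideanSpace ℝ (Fin n) → ℂ, AEStronglyMeasurable h volume ∧
      f =ᵐ[volume] (fun x => lowPart R g x + h x) ∧
      eLpNorm h 2 volume ≤ ENNReal.ofReal (R ^ (-s)) * weightedL2Norm s g := by
  set G : EuclideanSpace ℝ (Fin n) → ℂ := fun ξ => (1 - cutoff R ξ) • g ξ with hGdef
  have hGle := eLpNorm_one_sub_cutoff_smul_le hR hs g
  have hG : MemLp G 2 volume :=
    ⟨(continuous_const.sub (contDiff_cutoff R).continuous).aestronglyMeasurable.smul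
      hg.1.aestronglyMeasurable, hGle.trans_lt (ENNReal.mul_lt_top ENNReal.ofReal_lt_top hH)⟩
  set h : Lp ℂ 2 (volume : Measure (EuclideanSpace ℝ (Fin n))) := 𝓕⁻ (hG.toLp G) with hhdef
  have hnorm : eLpNorm h 2 volume = eLpNorm G 2 volume := by
    have : ‖h‖ = ‖hG.toLp G‖ := by
      rw [← Lp.norm_fourier_eq h, hhdef,
        FourierTransform.fourier_fourierInv_eq]
    rw [← eLpNorm_congr_ae (MemLp.coeFn_toLp hG)]
    rw [Lp.norm_def, Lp.norm_def] at this
    exact (ENNReal.toReal_eq_toReal_iff' (Lp.eLpNorm_ne_top _) (Lp.eLpNorm_ne_top _)).1 this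
  refine ⟨h, (Lp.memLp h).aestronglyMeasurable, ?_, hnorm.trans_le hGle⟩
  have hlow := integrable_cutoff_smul hR hg.1
  refine hf.ae_eq ⟨((continuous_lowPart hR hg.1).locallyIntegrable).add
    ((Lp.memLp h).locallyIntegrable one_le_two), fun φ hφ => ?_⟩
  have hI1 : Integrable (fun ξ => (𝓕⁻ φ) ξ • (cutoff R ξ • g ξ)) volume := by
    refine hlow.bdd_smul (SchwartzMap.seminorm ℂ 0 0 (𝓕⁻ φ))
      (𝓕⁻ φ).continuous.aestronglyMeasurable (Eventually.of_forall fun ξ => ?_)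
    exact SchwartzMap.norm_le_seminorm ℂ _ _
  have hI2 : Integrable (fun ξ => (𝓕⁻ φ) ξ • G ξ) volume :=
    MemLp.integrable_mul (𝓕⁻ φ |>.memLp 2 volume) hG
  have hI3 : Integrable (fun x => φ x • h x) volume :=
    MemLp.integrable_mul (φ.memLp 2 volume) (Lp.memLp h)
  have hI4 : Integrable (fun x => φ x • lowPart R g x) volume :=
    (continuous_lowPart hR hg.1).locallyIntegrable.integrable_smul_left_of_hasCompactSupport
      φ.continuous hφ
  have hsum : ∀ ξ, (𝓕⁻ φ) ξ • g ξ = (𝓕⁻ φ) ξ • (cutoff R ξ • g ξ) + (𝓕⁻ φ) ξ • G ξ := by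
    intro ξ; simp only [hGdef, smul_eq_mul]; ring
  have hT : T φ = (𝓕 T) (𝓕⁻ φ) := by
    rw [TemperedDistribution.fourier_apply, FourierTransform.fourier_fourierInv_eq]
  have hpair : ∫ ξ, (𝓕⁻ φ) ξ • G ξ = ∫ x, φ x • h x := by
    have h1 := congrArg (fun S : 𝓢'(EuclideanSpace ℝ (Fin n), ℂ) => S φ)
      (Lp.fourierInv_toTemperedDistribution_eq (hG.toLp G))
    simp only [TemperedDistribution.fourierInv_apply, Lp.toTemperedDistribution_apply] at h1
    rw [hhdef, ← h1]
    refine integral_congr_ae ?_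
    filter_upwards [hG.coeFn_toLp] with ξ hξ
    rw [hξ]
  rw [hT, hg.apply_eq_integral _ ((hI1.add hI2).congr (Eventually.of_forall fun ξ => (hsum ξ).symm))]
  simp only [hsum, smul_add]
  rw [integral_add hI1 hI2, integral_add hI4 hI3, hpair, ← integral_smul_fourierInv φ hlow]
  rfl

/-- Chebyshev's inequality for the high-frequency part, at a height twice the size of the
low-frequency part. -/
theorem distributionFunction_le_of_norm_lowPart_le {T : 𝓢'(EuclideanSpace ℝ (Fin n), ℂ)}
    {f g : EuclideanSpace ℝ (Fin n) → ℂ} (hf : IsGivenBy T f) (hg : IsGivenBy (𝓕 T) g)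
    {s R α : ℝ} (hs : 0 ≤ s) (hH : weightedL2Norm s g < ∞) (hR : 0 < R) (hα : 0 < α)
    (hlow : ∀ x, ‖lowPart R g x‖ ≤ α / 2) :
    distributionFunction f α ≤
      ENNReal.ofReal (4 * α ^ (-2 : ℝ) * R ^ (-2 * s) * (weightedL2Norm s g).toReal ^ 2) := by
  obtain ⟨h, hm, hfh, hle⟩ := exists_eq_lowPart_add hf hg hs hH hR
  have h1 : distributionFunction f α ≤ volume {x | ENNReal.ofReal (α / 2) ≤ ‖h x‖ₑ} := by
    refine measure_mono_ae ?_
    filter_upwards [hfh] with x hx hxα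
    change α < ‖f x‖ at hxα
    change ENNReal.ofReal (α / 2) ≤ ‖h x‖ₑ
    rw [← ofReal_norm]
    refine ENNReal.ofReal_le_ofReal ?_
    rw [hx] at hxα
    linarith [norm_add_le (lowPart R g x) (h x), hlow x]
  refine h1.trans ((meas_ge_le_mul_pow_eLpNorm_enorm volume two_ne_zero ENNReal.ofNat_ne_top hm
    (by simpa using hα) (by simp)).trans ?_)
  have hHr : weightedL2Norm s g = ENNReal.ofReal (weightedL2Norm s g).toReal :=
    (ENNReal.ofReal_toReal hH.ne).symm
  calc _ ≤ (ENNReal.ofReal (α / 2))⁻¹ ^ (2 : ℝ≥0∞).toReal *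
        (ENNReal.ofReal (R ^ (-s)) * weightedL2Norm s g) ^ (2 : ℝ≥0∞).toReal := by gcongr
    _ = _ := by
      conv_lhs => rw [hHr]
      rw [← ENNReal.ofReal_inv_of_pos (by positivity), ← ENNReal.ofReal_mul (by positivity),
        ENNReal.toReal_ofNat, ENNReal.ofReal_rpow_of_nonneg (by positivity) zero_le_two,
        ENNReal.ofReal_rpow_of_nonneg (by positivity) zero_le_two,
        ← ENNReal.ofReal_mul (by positivity)]
      congr 1
      have e1 : R ^ (-2 * s) = (R ^ (-s)) ^ 2 := by
        rw [← Real.rpow_natCast, ← Real.rpow_mul hR.le]; congr 1; push_cast; ring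
      rw [e1, Real.rpow_neg hα.le, Real.rpow_two, Real.rpow_two, Real.rpow_two]
      field_simp
      ring

/-! ### Bernstein's inequality -/

theorem fourier_cutoff {R : ℝ} (hR : 0 < R) (y : EuclideanSpace ℝ (Fin n)) :
    𝓕 (cutoff R : EuclideanSpace ℝ (Fin n) → ℂ) y =
      (R : ℂ) ^ n * 𝓕 (cutoff 1 : EuclideanSpace ℝ (Fin n) → ℂ) (R • y) := by
  rw [Real.fourier_eq, Real.fourier_eq]
  have h := Measure.integral_comp_smul (volume : Measure (EuclideanSpace ℝ (Fin n)))
    (fun η => Real.fourierChar (-(inner ℝ η (R • y))) • (cutoff 1 η : ℂ)) R⁻¹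
  have hp : |((R⁻¹ ^ Module.finrank ℝ (EuclideanSpace ℝ (Fin n)))⁻¹)| = R ^ n := by
    rw [finrank_euclideanSpace_fin, inv_pow, inv_inv, abs_of_pos (by positivity)]
  rw [hp, Complex.real_smul, Complex.ofReal_pow] at h
  rw [← h]
  refine integral_congr_ae (Eventually.of_forall fun ξ => ?_)
  simp only [cutoff, inv_one, one_smul, inner_smul_left, inner_smul_right]
  congr 3
  simp [hR.ne']

/-- Bernstein's inequality: a function in `L^p` has low-frequency part `O(R ^ (n / p))` in `L^∞`.
The value at `x` is the pairing of `f` with the Fourier transform of a modulated cutoff, that is,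
with the translated and dilated kernel `R ^ n κ(R (y - x))`, so Hölder's inequality applies. -/
theorem exists_norm_lowPart_le (n : ℕ) {p : ℝ} (hp : 1 < p) :
    ∃ C : ℝ, 0 < C ∧ ∀ (T : 𝓢'(EuclideanSpace ℝ (Fin n), ℂ))
      (f g : EuclideanSpace ℝ (Fin n) → ℂ), IsGivenBy T f → IsGivenBy (𝓕 T) g →
      MemLp f (ENNReal.ofReal p) volume → ∀ R : ℝ, 0 < R → ∀ x,
      ‖lowPart R g x‖ ≤ C * R ^ ((n : ℝ) / p) * (eLpNorm f (ENNReal.ofReal p) volume).toReal := by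
  set κ : 𝓢(EuclideanSpace ℝ (Fin n), ℂ) :=
    𝓕 ((hasCompactSupport_cutoff one_pos).toSchwartzMap (contDiff_cutoff 1)) with hκ
  have hκf : ∀ y, κ y = 𝓕 (cutoff 1 : EuclideanSpace ℝ (Fin n) → ℂ) y := fun y => rfl
  set p' : ℝ := p.conjExponent with hp'
  have hpp : p.HolderConjugate p' := Real.HolderConjugate.conjExponent hp
  have hp0 : 0 < p := by linarith
  have hp'0 : 0 < p' := hpp.symm.pos
  refine ⟨(∫ y, ‖κ y‖ ^ p') ^ (1 / p') + 1, by positivity, fun T f g hf hg hfp R hR x => ?_⟩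
  -- the test function whose pairing with `g` is the value of the low-frequency part at `x`
  set u : EuclideanSpace ℝ (Fin n) → ℂ := fun ξ =>
    Complex.exp (2 * Real.pi * (inner ℝ ξ x : ℝ) * Complex.I) * cutoff R ξ with hu
  have hus : HasCompactSupport u := (hasCompactSupport_cutoff hR).mul_left
  have huc : ContDiff ℝ ((⊤ : ℕ∞) : WithTop ℕ∞) u := by
    refine ContDiff.mul ?_ (contDiff_cutoff R)
    refine ContDiff.cexp (ContDiff.mul (ContDiff.mul contDiff_const ?_) contDiff_const)
    exact Complex.ofRealCLM.contDiff.comp (contDiff_id.inner ℝ contDiff_const)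
  set Φ : 𝓢(EuclideanSpace ℝ (Fin n), ℂ) := hus.toSchwartzMap huc with hΦ
  have hker : ∀ y, (𝓕 Φ) y = (R : ℂ) ^ n * κ (R • (y - x)) := by
    intro y
    rw [hκf, ← fourier_cutoff hR, SchwartzMap.fourier_coe, Real.fourier_eq, Real.fourier_eq]
    refine integral_congr_ae (Eventually.of_forall fun ξ => ?_)
    simp only [Circle.smul_def, Real.fourierChar_apply, smul_eq_mul]
    change _ * u ξ = _
    rw [hu, ← mul_assoc, ← Complex.exp_add, inner_sub_right]
    congr 2
    push_cast
    ring
  have hfL : Integrable (fun y => (𝓕 Φ) y • f y) volume := by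
    have : ENNReal.HolderConjugate (ENNReal.ofReal p') (ENNReal.ofReal p) := by
      exact hpp.symm.ennrealOfReal
    exact MemLp.integrable_mul ((𝓕 Φ).memLp (ENNReal.ofReal p') volume) hfp
  have hval : lowPart R g x = ∫ y, (𝓕 Φ) y • f y := by
    rw [← hf.apply_eq_integral _ hfL, ← TemperedDistribution.fourier_apply,
      hg.2 Φ hus, lowPart, Real.fourierInv_eq]
    refine integral_congr_ae (Eventually.of_forall fun ξ => ?_)
    change _ = u ξ • g ξ
    simp only [hu, Circle.smul_def, Real.fourierChar_apply, smul_eq_mul]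
    push_cast
    ring
  have hkint : ∫ y, ‖(𝓕 Φ) y‖ ^ p' = R ^ (n * p' - n) * ∫ y, ‖κ y‖ ^ p' := by
    have e1 : ∀ y, ‖(𝓕 Φ) y‖ ^ p' = R ^ (n * p') * ‖κ (R • (y - x))‖ ^ p' := by
      intro y
      rw [hker, norm_mul, Real.mul_rpow (norm_nonneg _) (norm_nonneg _), norm_pow,
        Complex.norm_real, Real.norm_of_nonneg hR.le, Real.rpow_mul hR.le, Real.rpow_natCast]
    simp_rw [e1]
    rw [integral_const_mul, integral_sub_right_eq_self (fun y => ‖κ (R • y)‖ ^ p') x,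
      Measure.integral_comp_smul volume (fun y => ‖κ y‖ ^ p') R, finrank_euclideanSpace_fin,
      abs_of_pos (by positivity), smul_eq_mul, ← mul_assoc, Real.rpow_sub hR, Real.rpow_natCast]
    rfl
  have hN : (eLpNorm f (ENNReal.ofReal p) volume).toReal = (∫ y, ‖f y‖ ^ p) ^ (1 / p) := by
    rw [hfp.eLpNorm_eq_integral_rpow_norm (by simpa using hp0) (by simp),
      ENNReal.toReal_ofReal (by positivity), ENNReal.toReal_ofReal hp0.le, one_div]
  have hHol : ‖lowPart R g x‖ ≤ (∫ y, ‖(𝓕 Φ) y‖ ^ p') ^ (1 / p') *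
      (∫ y, ‖f y‖ ^ p) ^ (1 / p) := by
    rw [hval]
    refine (norm_integral_le_integral_norm _).trans ?_
    simp_rw [norm_smul]
    exact integral_mul_norm_le_Lp_mul_Lq hpp.symm ((𝓕 Φ).memLp _ volume) hfp
  refine hHol.trans ?_
  rw [hN]
  refine mul_le_mul_of_nonneg_right ?_ (by positivity)
  have hexp : (n * p' - n) * (1 / p') = (n : ℝ) / p := by
    have := hpp.inv_add_inv_eq_one
    have h2 : (1 : ℝ) - 1 / p' = 1 / p := by rw [one_div, one_div]; linarith
    rw [div_eq_mul_one_div (n : ℝ) p, ← h2]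
    field_simp
  rw [hkint, Real.mul_rpow (by positivity) (by positivity), ← Real.rpow_mul hR.le, hexp, mul_comm]
  refine mul_le_mul_of_nonneg_right (by linarith) (by positivity)

/-! ### Distribution functions and the layer cake formula -/

theorem distributionFunction_le_of_weakLpNorm_lt_top {f : EuclideanSpace ℝ (Fin n) → ℂ} {q : ℝ}
    (hq : 0 < q) (hf : weakLpNorm f q < ∞) {α : ℝ} (hα : 0 < α) :
    distributionFunction f α ≤ ENNReal.ofReal ((weakLpNorm f q).toReal ^ q * α ^ (-q)) := by
  have h1 : ENNReal.ofReal α * distributionFunction f α ^ (1 / q) ≤ weakLpNorm f q :=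
    le_iSup₂_of_le (f := fun (γ : ℝ) (_ : 0 < γ) =>
      ENNReal.ofReal γ * distributionFunction f γ ^ (1 / q)) α hα le_rfl
  have hα0 : ENNReal.ofReal α ≠ 0 := by simpa using hα
  have h2 : distributionFunction f α ^ (1 / q) ≤
      ENNReal.ofReal ((weakLpNorm f q).toReal * α⁻¹) := by
    rw [ENNReal.ofReal_mul ENNReal.toReal_nonneg, ENNReal.ofReal_toReal hf.ne,
      ENNReal.ofReal_inv_of_pos hα, ← div_eq_mul_inv,
      ENNReal.le_div_iff_mul_le (Or.inl hα0) (Or.inl ENNReal.ofReal_ne_top), mul_comm]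
    exact h1
  calc distributionFunction f α = (distributionFunction f α ^ (1 / q)) ^ q := by
        rw [← ENNReal.rpow_mul, one_div_mul_cancel hq.ne', ENNReal.rpow_one]
    _ ≤ ENNReal.ofReal ((weakLpNorm f q).toReal * α⁻¹) ^ q := by gcongr
    _ = _ := by
      rw [ENNReal.ofReal_rpow_of_nonneg (by positivity) hq.le,
        Real.mul_rpow (by positivity) (by positivity), Real.inv_rpow hα.le, Real.rpow_neg hα.le]

/-- The layer cake formula for a distribution function that decays like `α ^ (-q)` below the height
`α₀` and like `α ^ (-r)` above it, with `q < p < r`. -/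
theorem lintegral_rpow_norm_le_of_distributionFunction_le {f : EuclideanSpace ℝ (Fin n) → ℂ}
    (hf : AEStronglyMeasurable f volume) {p q r α₀ A B : ℝ} (hp : 0 < p) (hqp : q < p)
    (hpr : p < r) (hα₀ : 0 < α₀) (hA : 0 ≤ A) (hB : 0 ≤ B)
    (h1 : ∀ α, 0 < α → distributionFunction f α ≤ ENNReal.ofReal (A * α ^ (-q)))
    (h2 : ∀ α, α₀ ≤ α → distributionFunction f α ≤ ENNReal.ofReal (B * α ^ (-r))) :
    ∫⁻ x, ENNReal.ofReal (‖f x‖ ^ p) ≤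
      ENNReal.ofReal (p * (A * (α₀ ^ (p - q) / (p - q)) + B * (α₀ ^ (p - r) / (r - p)))) := by
  rw [lintegral_rpow_eq_lintegral_meas_lt_mul volume (Eventually.of_forall fun x => norm_nonneg _)
    hf.norm.aemeasurable hp, ENNReal.ofReal_mul hp.le]
  refine mul_le_mul_right ?_ _
  rw [← Set.Ioc_union_Ioi_eq_Ioi hα₀.le, lintegral_union measurableSet_Ioi
    (Set.Ioc_disjoint_Ioi le_rfl), ENNReal.ofReal_add
      (mul_nonneg hA (div_nonneg (by positivity) (by linarith)))
      (mul_nonneg hB (div_nonneg (by positivity) (by linarith)))]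
  refine add_le_add ?_ ?_
  · have hi : IntegrableOn (fun t : ℝ => t ^ (p - q - 1)) (Set.Ioc 0 α₀) volume :=
      (intervalIntegrable_iff_integrableOn_Ioc_of_le hα₀.le).1
        (intervalIntegral.intervalIntegrable_rpow' (by linarith))
    have hval : ∫ t in Set.Ioc 0 α₀, A * t ^ (p - q - 1) = A * (α₀ ^ (p - q) / (p - q)) := by
      rw [integral_const_mul, ← intervalIntegral.integral_of_le hα₀.le,
        integral_rpow (Or.inl (by linarith)), sub_add_cancel, Real.zero_rpow (by linarith), sub_zero]
    rw [← hval, ofReal_integral_eq_lintegral_ofReal (hi.const_mul A)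
      ((ae_restrict_mem measurableSet_Ioc).mono fun t ht =>
        mul_nonneg hA (Real.rpow_nonneg ht.1.le _))]
    refine setLIntegral_mono' measurableSet_Ioc fun t ht => ?_
    refine (mul_le_mul_left (h1 t ht.1) _).trans_eq ?_
    rw [← ENNReal.ofReal_mul (mul_nonneg hA (Real.rpow_nonneg ht.1.le _)), mul_assoc,
      ← Real.rpow_add ht.1]
    ring_nf
  · have hi : IntegrableOn (fun t : ℝ => t ^ (p - r - 1)) (Set.Ioi α₀) volume :=
      integrableOn_Ioi_rpow_of_lt (by linarith) hα₀
    have hval : ∫ t in Set.Ioi α₀, B * t ^ (p - r - 1) = B * (α₀ ^ (p - r) / (r - p)) := by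
      rw [integral_const_mul, integral_Ioi_rpow_of_lt (by linarith) hα₀, sub_add_cancel,
        ← neg_sub r p, div_neg, neg_div, neg_neg]
    rw [← hval, ofReal_integral_eq_lintegral_ofReal (hi.const_mul B)
      ((ae_restrict_mem measurableSet_Ioi).mono fun t ht =>
        mul_nonneg hB (Real.rpow_nonneg (hα₀.trans ht).le _))]
    refine setLIntegral_mono' measurableSet_Ioi fun t ht => ?_
    have ht0 : 0 < t := hα₀.trans ht
    refine (mul_le_mul_left (h2 t (le_of_lt ht)) _).trans_eq ?_
    rw [← ENNReal.ofReal_mul (mul_nonneg hB (Real.rpow_nonneg ht0.le _)), mul_assoc,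
      ← Real.rpow_add ht0]
    ring_nf

/-! ### Membership in `L^p` -/

/-- The `L¹` norm of `g` over a ball of radius `2ρ` grows at most like `ρ ^ (n / 2 - σ)`, for every
`σ ≤ s` with `σ < n / 2`.  Off the unit ball this is the Cauchy–Schwarz inequality for `‖ξ‖ ^ (-σ)`
and `‖ξ‖ ^ s ‖g ξ‖`, in the form `b ≤ 1 / a + a b²` with a weight chosen according to `ρ`; on the unit
ball it uses the local integrability of `g`. -/
theorem exists_setIntegral_closedBall_norm_le (hn : 1 ≤ n) {s σ : ℝ} (hσs : σ ≤ s)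
    (hσn : 2 * σ < n) {g : EuclideanSpace ℝ (Fin n) → ℂ} (hg : LocallyIntegrable g volume)
    (hH : weightedL2Norm s g < ∞) :
    ∃ A K : ℝ, 0 < A ∧ 0 ≤ K ∧ ∀ ρ : ℝ, 1 ≤ ρ →
      ∫ ξ in Metric.closedBall 0 (2 * ρ), ‖g ξ‖ ≤ A + K * ρ ^ ((n : ℝ) / 2 - σ) := by
  set J : ℝ := ∫ ξ in Metric.closedBall (0 : EuclideanSpace ℝ (Fin n)) 2, ‖ξ‖ ^ (-(2 * σ)) with hJ
  have hJ0 : 0 ≤ J := integral_nonneg fun ξ => by positivity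
  set M : ℝ := ∫ ξ, ‖ξ‖ ^ (2 * s) * ‖g ξ‖ ^ 2 with hM
  have hM0 : 0 ≤ M := integral_nonneg fun ξ => by positivity
  have hA0 : 0 ≤ ∫ ξ in Metric.closedBall (0 : EuclideanSpace ℝ (Fin n)) 1, ‖g ξ‖ :=
    integral_nonneg fun ξ => norm_nonneg _
  have hMint : Integrable (fun ξ => ‖ξ‖ ^ (2 * s) * ‖g ξ‖ ^ 2) volume := by
    refine ⟨?_, ?_⟩
    · exact ((measurable_norm.pow_const _).aestronglyMeasurable).mul
        (hg.aestronglyMeasurable.norm.pow 2)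
    · rw [hasFiniteIntegral_iff_ofReal (Eventually.of_forall fun ξ => by positivity)]
      exact (ENNReal.rpow_lt_top_iff_of_pos (by norm_num)).1 hH
  have hwint : LocallyIntegrable (fun ξ : EuclideanSpace ℝ (Fin n) => ‖ξ‖ ^ (-(2 * σ))) volume := by
    refine locallyIntegrable_of_norm_le_rpow (C := 1) (α := 2 * σ) (by simpa using hn)
      (by simpa using hσn) (Eventually.of_forall fun ξ => ?_)
      (measurable_norm.pow_const _).aestronglyMeasurable
    rw [one_mul, Real.norm_of_nonneg (by positivity)]
  refine ⟨(∫ ξ in Metric.closedBall (0 : EuclideanSpace ℝ (Fin n)) 1, ‖g ξ‖) + 1, J + M,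
    by positivity, by positivity, fun ρ hρ => ?_⟩
  have hρ0 : 0 < ρ := one_pos.trans_le hρ
  -- the weight for which the two terms of the arithmetic-geometric mean bound balance
  set l : ℝ := ρ ^ ((n : ℝ) / 2 - σ) with hl
  have hl0 : 0 < l := by positivity
  set S := Metric.closedBall (0 : EuclideanSpace ℝ (Fin n)) (2 * ρ) with hS
  have hSm : MeasurableSet S := Metric.isClosed_closedBall.measurableSet
  have hball : MeasurableSet (Metric.closedBall (0 : EuclideanSpace ℝ (Fin n)) 1) :=
    Metric.isClosed_closedBall.measurableSet
  have hi0 : Integrable ((Metric.closedBall (0 : EuclideanSpace ℝ (Fin n)) 1).indicator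
      fun ξ => ‖g ξ‖) volume :=
    (integrable_indicator_iff hball).2 (hg.integrableOn_isCompact (isCompact_closedBall _ _)).norm
  have hi1 : IntegrableOn (fun ξ : EuclideanSpace ℝ (Fin n) => l⁻¹ * ‖ξ‖ ^ (-(2 * σ))) S volume :=
    (hwint.integrableOn_isCompact (isCompact_closedBall _ _)).const_mul _
  have hi2 : Integrable (fun ξ => l * (‖ξ‖ ^ (2 * s) * ‖g ξ‖ ^ 2)) volume := hMint.const_mul _
  have hi01 : IntegrableOn (fun ξ => (Metric.closedBall (0 : EuclideanSpace ℝ (Fin n)) 1).indicator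
      (fun ξ => ‖g ξ‖) ξ + l⁻¹ * ‖ξ‖ ^ (-(2 * σ))) S volume := hi0.integrableOn.add hi1
  have hscale : ∫ ξ in S, ‖ξ‖ ^ (-(2 * σ)) = l ^ 2 * J := by
    have h := Measure.setIntegral_comp_smul_of_pos
      (volume : Measure (EuclideanSpace ℝ (Fin n))) (fun ξ => ‖ξ‖ ^ (-(2 * σ)))
      (Metric.closedBall (0 : EuclideanSpace ℝ (Fin n)) 2) hρ0
    have hset : ρ • Metric.closedBall (0 : EuclideanSpace ℝ (Fin n)) 2 = S := by
      rw [smul_closedBall' hρ0.ne', smul_zero, Real.norm_of_nonneg hρ0.le, mul_comm]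
    rw [hset, finrank_euclideanSpace_fin] at h
    simp_rw [norm_smul, Real.norm_of_nonneg hρ0.le,
      Real.mul_rpow hρ0.le (norm_nonneg _)] at h
    rw [integral_const_mul, smul_eq_mul, ← hJ] at h
    have hl2 : l ^ 2 = ρ ^ n * ρ ^ (-(2 * σ)) := by
      rw [hl, ← Real.rpow_natCast, ← Real.rpow_mul hρ0.le, ← Real.rpow_natCast ρ n,
        ← Real.rpow_add hρ0]
      congr 1; push_cast; ring
    rw [hl2, mul_assoc, h, mul_inv_cancel_left₀ (by positivity)]
  have hpt : ∀ ξ ∈ S, ‖g ξ‖ ≤ (Metric.closedBall (0 : EuclideanSpace ℝ (Fin n)) 1).indicator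
      (fun ξ => ‖g ξ‖) ξ + l⁻¹ * ‖ξ‖ ^ (-(2 * σ)) + l * (‖ξ‖ ^ (2 * s) * ‖g ξ‖ ^ 2) := by
    intro ξ _
    by_cases hξ : ξ ∈ Metric.closedBall (0 : EuclideanSpace ℝ (Fin n)) 1
    · rw [Set.indicator_of_mem hξ]
      have : 0 ≤ l⁻¹ * ‖ξ‖ ^ (-(2 * σ)) := by positivity
      have : 0 ≤ l * (‖ξ‖ ^ (2 * s) * ‖g ξ‖ ^ 2) := by positivity
      linarith
    · rw [Set.indicator_of_notMem hξ, zero_add]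
      simp only [Metric.mem_closedBall, dist_zero_right, not_le] at hξ
      have hξ0 : 0 < ‖ξ‖ := one_pos.trans hξ
      have hmono : ‖ξ‖ ^ (2 * σ) ≤ ‖ξ‖ ^ (2 * s) :=
        Real.rpow_le_rpow_of_exponent_le hξ.le (by linarith)
      set w := ‖ξ‖ ^ (2 * σ) with hw
      have hw0 : 0 < w := by positivity
      rw [Real.rpow_neg hξ0.le, ← hw]
      have h3 : l * (w * ‖g ξ‖ ^ 2) ≤ l * (‖ξ‖ ^ (2 * s) * ‖g ξ‖ ^ 2) := by gcongr
      refine le_trans ?_ (add_le_add_right h3 _)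
      -- the arithmetic-geometric mean inequality `b ≤ 1 / a + a * b ^ 2`
      have h4 : l⁻¹ * w⁻¹ + l * (w * ‖g ξ‖ ^ 2) - ‖g ξ‖ =
          (l * w)⁻¹ * ((l * w * ‖g ξ‖ - 1 / 2) ^ 2 + 3 / 4) := by
        field_simp
        ring
      have h5 : 0 ≤ (l * w)⁻¹ * ((l * w * ‖g ξ‖ - 1 / 2) ^ 2 + 3 / 4) := by positivity
      linarith
  calc ∫ ξ in S, ‖g ξ‖
      ≤ ∫ ξ in S, ((Metric.closedBall (0 : EuclideanSpace ℝ (Fin n)) 1).indicator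
          (fun ξ => ‖g ξ‖) ξ + l⁻¹ * ‖ξ‖ ^ (-(2 * σ)) + l * (‖ξ‖ ^ (2 * s) * ‖g ξ‖ ^ 2)) :=
        setIntegral_mono_on (hg.integrableOn_isCompact (isCompact_closedBall _ _)).norm
          (hi01.add hi2.integrableOn) hSm hpt
    _ = (∫ ξ in S, (Metric.closedBall (0 : EuclideanSpace ℝ (Fin n)) 1).indicator
          (fun ξ => ‖g ξ‖) ξ) + l * J + l * ∫ ξ in S, ‖ξ‖ ^ (2 * s) * ‖g ξ‖ ^ 2 := by
        rw [integral_add hi01 hi2.integrableOn,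
          integral_add hi0.integrableOn hi1, integral_const_mul, integral_const_mul, hscale]
        congr 2
        field_simp
    _ ≤ (∫ ξ in Metric.closedBall (0 : EuclideanSpace ℝ (Fin n)) 1, ‖g ξ‖) + l * J + l * M := by
        gcongr
        · refine (setIntegral_le_integral hi0 (Eventually.of_forall fun ξ =>
            Set.indicator_nonneg (fun _ _ => norm_nonneg _) _)).trans_eq ?_
          exact integral_indicator hball
        · exact setIntegral_le_integral hMint (Eventually.of_forall fun ξ => by positivity)
    _ ≤ _ := by rw [hl]; linarith

/-- The qualitative half of the interpolation inequality.  At large heights `α`, cutting frequencies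
where the low part reaches `α / 2` gives a distribution function `O(α ^ (-r))` with `r > p`; at small
heights the weak `L^q` bound suffices.  No bound on the norm uniform in `f` results, since the size
of `g` near the origin enters. -/
theorem memLp_of_weakLpNorm_lt_top (hn : 1 ≤ n) {p q s : ℝ} (hq : 1 ≤ q) (hqp : q < p)
    (hs : 0 ≤ s) (hsp : (n : ℝ) * (1 / 2 - 1 / p) < s) {T : 𝓢'(EuclideanSpace ℝ (Fin n), ℂ)}
    {f g : EuclideanSpace ℝ (Fin n) → ℂ} (hf : IsGivenBy T f) (hg : IsGivenBy (𝓕 T) g)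
    (hW : weakLpNorm f q < ∞) (hH : weightedL2Norm s g < ∞) :
    MemLp f (ENNReal.ofReal p) volume := by
  have hp : 0 < p := by linarith
  have hn0 : (0 : ℝ) < n := by exact_mod_cast hn
  have hlt : (n : ℝ) * (1 / 2 - 1 / p) < n / 2 := by
    have : 0 < (n : ℝ) * (1 / p) := by positivity
    linarith
  -- a smoothness index `σ` below `n / 2` that still satisfies the condition on `s`
  obtain ⟨σ, hσp, hσ⟩ := exists_between (lt_min hsp hlt)
  have hσs : σ ≤ s := (hσ.trans_le (min_le_left _ _)).le
  have hσn : 2 * σ < n := by linarith [hσ.trans_le (min_le_right _ _)]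
  obtain ⟨A, K, hA, hK, hAK⟩ := exists_setIntegral_closedBall_norm_le hn hσs hσn hg.1 hH
  set e : ℝ := (n : ℝ) / 2 - σ with he
  have he0 : 0 < e := by linarith
  set r : ℝ := 2 + 2 * σ / e with hr
  have hpr : p < r := by
    have h1 : (n : ℝ) * (1 / 2 - 1 / p) * p = n * p / 2 - n := by field_simp
    have h2 := mul_lt_mul_of_pos_right hσp hp
    have h3 : (p - 2) * e < 2 * σ := by rw [he]; nlinarith
    have := (lt_div_iff₀ he0).2 h3
    linarith
  set α₀ : ℝ := 2 * (A + K) with hα₀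
  have hα₀0 : 0 < α₀ := by positivity
  set H : ℝ := (weightedL2Norm s g).toReal with hHdef
  have hlarge : ∀ α, α₀ ≤ α → distributionFunction f α ≤
      ENNReal.ofReal (4 * α₀ ^ (2 * σ / e) * H ^ 2 * α ^ (-r)) := by
    intro α hα
    have hα0 : 0 < α := hα₀0.trans_le hα
    have hone : 1 ≤ α / α₀ := (one_le_div hα₀0).2 hα
    -- at this radius the low-frequency part is at most `α / 2`
    set ρ : ℝ := (α / α₀) ^ (1 / e) with hρ
    have hρ1 : 1 ≤ ρ := Real.one_le_rpow hone (by positivity)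
    have hρ0 : 0 < ρ := one_pos.trans_le hρ1
    have hρe : ρ ^ e = α / α₀ := by
      rw [hρ, ← Real.rpow_mul (by positivity), one_div_mul_cancel he0.ne', Real.rpow_one]
    have hlow : ∀ x, ‖lowPart ρ g x‖ ≤ α / 2 := by
      intro x
      refine (norm_lowPart_le hρ0 hg.1 x).trans ((hAK ρ hρ1).trans ?_)
      rw [hρe]
      have h1 : A ≤ A * (α / α₀) := le_mul_of_one_le_right hA.le hone
      have h2 : A * (α / α₀) + K * (α / α₀) = α / 2 := by
        rw [← add_mul, hα₀]; field_simp
      linarith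
    refine (distributionFunction_le_of_norm_lowPart_le hf hg hs hH hρ0 hα0 hlow).trans
      (ENNReal.ofReal_le_ofReal ?_)
    calc 4 * α ^ (-2 : ℝ) * ρ ^ (-2 * s) * H ^ 2 ≤ 4 * α ^ (-2 : ℝ) * ρ ^ (-2 * σ) * H ^ 2 := by
          gcongr 4 * α ^ (-2 : ℝ) * ?_ * H ^ 2
          exact Real.rpow_le_rpow_of_exponent_le hρ1 (by linarith)
      _ = 4 * α₀ ^ (2 * σ / e) * H ^ 2 * α ^ (-r) := by
          have h1 : ρ ^ (-2 * σ) = α ^ (-(2 * σ / e)) * α₀ ^ (2 * σ / e) := by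
            rw [hρ, ← Real.rpow_mul (by positivity), Real.div_rpow hα0.le hα₀0.le,
              div_eq_mul_inv, ← Real.rpow_neg hα₀0.le]
            congr 2 <;> ring
          have h2 : α ^ (-r) = α ^ (-2 : ℝ) * α ^ (-(2 * σ / e)) := by
            rw [← Real.rpow_add hα0, hr]; congr 1; ring
          rw [h1, h2]; ring
  have hfm := hf.1.aestronglyMeasurable
  have hfin := (lintegral_rpow_norm_le_of_distributionFunction_le hfm hp hqp hpr hα₀0
    (by positivity) (by positivity)
    (fun α hα => distributionFunction_le_of_weakLpNorm_lt_top (by linarith) hW hα) hlarge).trans_lt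
    ENNReal.ofReal_lt_top
  refine ⟨hfm, ?_⟩
  rw [eLpNorm_lt_top_iff_lintegral_rpow_enorm_lt_top (by simpa using hp) (by simp),
    ENNReal.toReal_ofReal hp.le]
  refine lt_of_eq_of_lt (lintegral_congr fun x => ?_) hfin
  rw [← ofReal_norm, ENNReal.ofReal_rpow_of_nonneg (norm_nonneg _) hp.le]

/-! ### The quantitative inequality by absorption -/

/-- The absorption argument.  Here `N`, `W` and `H` stand for the `L^p`, the weak `L^q` and the Sobolev
norm, and the hypothesis is the layer cake bound split at an arbitrary height `α₀`, whose tail carries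
the power `N ^ (r - 2)` from Bernstein's inequality.  The weak-norm term can be made `N ^ p / 2` by
choice of `α₀`; what remains bounds a positive power of `N`. -/
theorem rpow_le_of_layer_cake_bound {p q r D N W H : ℝ} (hq : 0 < q) (hqp : q < p) (hpr : p < r)
    (hD : 0 < D) (hN : 0 < N) (hW : 0 < W)
    (h : ∀ α₀, 0 < α₀ → N ^ p ≤ p * (W ^ q * (α₀ ^ (p - q) / (p - q)) +
      4 * (D * N) ^ (r - 2) * H ^ 2 * (α₀ ^ (p - r) / (r - p)))) :
    N ^ (q * ((r - p) / (p - q)) + 2) ≤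
      (8 * p / (r - p) * D ^ (r - 2) * ((p - q) / (2 * p)) ^ (-((r - p) / (p - q)))) *
        W ^ (q * ((r - p) / (p - q))) * H ^ 2 := by
  have hp : 0 < p := hq.trans hqp
  have hpq : 0 < p - q := by linarith
  have hrp : 0 < r - p := by linarith
  set m : ℝ := (r - p) / (p - q) with hm
  set c : ℝ := (p - q) / (2 * p) with hc
  have hc0 : 0 < c := by positivity
  -- the height at which the contribution of small values is half of `N ^ p`
  set α₀ : ℝ := (c * (N ^ p * W ^ (-q))) ^ (1 / (p - q)) with hα₀
  have hα₀0 : 0 < α₀ := by positivity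
  have e1 : α₀ ^ (p - q) = c * (N ^ p * W ^ (-q)) := by
    rw [hα₀, ← Real.rpow_mul (by positivity), one_div_mul_cancel hpq.ne', Real.rpow_one]
  have e2 : α₀ ^ (p - r) = c ^ (-m) * (N ^ (-(p * m)) * W ^ (q * m)) := by
    rw [hα₀, ← Real.rpow_mul (by positivity), Real.mul_rpow hc0.le (by positivity),
      Real.mul_rpow (by positivity) (by positivity), ← Real.rpow_mul hN.le, ← Real.rpow_mul hW.le]
    congr 2
    · rw [hm]; field_simp; ring
    · congr 1; rw [hm]; field_simp; ring
    · congr 1; rw [hm]; field_simp; ring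
  have h0 := h α₀ hα₀0
  rw [e1, e2, Real.mul_rpow hD.le hN.le] at h0
  have e3 : p * (W ^ q * (c * (N ^ p * W ^ (-q)) / (p - q))) = N ^ p / 2 := by
    rw [Real.rpow_neg hW.le, hc]
    field_simp
  have h1 : N ^ p ≤ 8 * p / (r - p) * D ^ (r - 2) * c ^ (-m) * W ^ (q * m) * H ^ 2 *
      (N ^ (r - 2) * N ^ (-(p * m))) := by
    have e4 : p * (4 * (D ^ (r - 2) * N ^ (r - 2)) * H ^ 2 *
        (c ^ (-m) * (N ^ (-(p * m)) * W ^ (q * m)) / (r - p))) =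
        (8 * p / (r - p) * D ^ (r - 2) * c ^ (-m) * W ^ (q * m) * H ^ 2 *
          (N ^ (r - 2) * N ^ (-(p * m)))) / 2 := by
      field_simp
      ring
    rw [mul_add, e3, e4] at h0
    linarith
  rw [← Real.rpow_add hN] at h1
  have e5 : N ^ (q * m + 2) = N ^ p / N ^ (r - 2 + -(p * m)) := by
    rw [← Real.rpow_sub hN]
    congr 1
    have : m * (p - q) = r - p := by rw [hm]; field_simp
    linear_combination -this
  rw [e5, div_le_iff₀ (by positivity)]
  exact h1

/-- The Gagliardo–Nirenberg inequality with a weak Lebesgue norm.  The interpolation parameter appears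
as `θ = a / (a + 2)`, where `N ^ (a + 2) ≤ L W ^ a H ^ 2` is the outcome of the absorption. -/
theorem exists_eLpNorm_le (hn : 1 ≤ n) {p q s : ℝ} (hq : 1 ≤ q) (hqp : q < p)
    (hs : 0 ≤ s) (hsp : (n : ℝ) * (1 / 2 - 1 / p) < s) :
    ∃ θ : ℝ, 0 < θ ∧ θ < 1 ∧ 1 / p = θ / q + (1 - θ) * (1 / 2 - s / (n : ℝ)) ∧
      ∃ c : ℝ≥0, ∀ (f : EuclideanSpace ℝ (Fin n) → ℂ) (T : 𝓢'(EuclideanSpace ℝ (Fin n), ℂ)),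
        IsGivenBy T f → MemWeakLp f q → MemHomSobolev s T →
        MemLp f (ENNReal.ofReal p) volume ∧
        eLpNorm f (ENNReal.ofReal p) volume ≤
          (c : ℝ≥0∞) * weakLpNorm f q ^ θ * homSobolevNorm s T ^ (1 - θ) := by
  have hq0 : 0 < q := by linarith
  have hp : 0 < p := by linarith
  have hn0 : (0 : ℝ) < n := by exact_mod_cast hn
  have hpq : 0 < p - q := by linarith
  set r : ℝ := 2 + 2 * s * p / n with hr
  have hpr : p < r := by
    have h1 : (n : ℝ) * (1 / 2 - 1 / p) * p = n * p / 2 - n := by field_simp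
    have h2 := mul_lt_mul_of_pos_right hsp hp
    have h3 : (p - 2) * n < 2 * s * p := by nlinarith
    have := (lt_div_iff₀ hn0).2 h3
    linarith
  have hrp : 0 < r - p := by linarith
  set a : ℝ := q * ((r - p) / (p - q)) with ha
  have ha0 : 0 < a := by positivity
  have hθ : 1 - a / (a + 2) = 2 / (a + 2) := by field_simp; ring
  obtain ⟨C, hC, hlowC⟩ := exists_norm_lowPart_le n (hq.trans_lt hqp)
  set L : ℝ := 8 * p / (r - p) * (2 * C) ^ (r - 2) *
    ((p - q) / (2 * p)) ^ (-((r - p) / (p - q))) with hL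
  have hL0 : 0 ≤ L := by positivity
  refine ⟨a / (a + 2), by positivity, (div_lt_one (by positivity)).2 (by linarith), ?_,
    Real.toNNReal (L ^ (1 / (a + 2))), fun f T hf hfW hT => ?_⟩
  · rw [hθ]
    have hsn : s / n = (r - 2) / (2 * p) := by rw [hr]; field_simp; ring
    have haq : a / q * (p - q) = r - p := by rw [ha]; field_simp
    rw [hsn]
    have key : (a + 2) / p = a / q + 2 * (1 / 2 - (r - 2) / (2 * p)) := by
      have : r = a / q * (p - q) + p := by linarith
      rw [this]; field_simp; ring
    calc 1 / p = ((a + 2) / p) / (a + 2) := by field_simp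
      _ = _ := by rw [key]; field_simp
  obtain ⟨g, hg, hH⟩ := hT
  have hW := hfW.2
  have hmem := memLp_of_weakLpNorm_lt_top hn hq hqp hs hsp hf hg hW hH
  refine ⟨hmem, ?_⟩
  rw [homSobolevNorm_eq s hg]
  set N : ℝ := (eLpNorm f (ENNReal.ofReal p) volume).toReal with hN
  set W : ℝ := (weakLpNorm f q).toReal with hWdef
  set H : ℝ := (weightedL2Norm s g).toReal with hHdef
  have hN' : eLpNorm f (ENNReal.ofReal p) volume = ENNReal.ofReal N :=
    (ENNReal.ofReal_toReal hmem.2.ne).symm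
  have hN_nonneg : 0 ≤ N := ENNReal.toReal_nonneg
  have hW_nonneg : 0 ≤ W := ENNReal.toReal_nonneg
  rcases hN_nonneg.eq_or_lt with hN0 | hN0
  · rw [hN', ← hN0]; simp
  have hNp : ∫⁻ x, ENNReal.ofReal (‖f x‖ ^ p) = ENNReal.ofReal (N ^ p) := by
    rw [← ENNReal.ofReal_rpow_of_nonneg hN0.le hp.le, ← hN',
      eLpNorm_eq_lintegral_rpow_enorm_toReal (by simpa using hp) (by simp),
      ENNReal.toReal_ofReal hp.le, ← ENNReal.rpow_mul, one_div_mul_cancel hp.ne', ENNReal.rpow_one]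
    refine lintegral_congr fun x => ?_
    rw [← ofReal_norm, ENNReal.ofReal_rpow_of_nonneg (norm_nonneg _) hp.le]
  have hlarge : ∀ α, 0 < α → distributionFunction f α ≤
      ENNReal.ofReal (4 * (2 * C * N) ^ (r - 2) * H ^ 2 * α ^ (-r)) := by
    intro α hα
    set b : ℝ := α / (2 * C * N) with hb
    have hb0 : 0 < b := by positivity
    -- the radius at which Bernstein's inequality bounds the low-frequency part by `α / 2`
    have hRp : (b ^ (p / n)) ^ ((n : ℝ) / p) = b := by
      rw [← Real.rpow_mul hb0.le, div_mul_div_cancel₀ hn0.ne', div_self hp.ne', Real.rpow_one]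
    have hlow : ∀ x, ‖lowPart (b ^ (p / n)) g x‖ ≤ α / 2 := by
      intro x
      refine (hlowC T f g hf hg hmem _ (by positivity) x).trans_eq ?_
      rw [hRp, ← hN, hb]
      field_simp
    refine (distributionFunction_le_of_norm_lowPart_le hf hg hs hH (by positivity) hα
      hlow).trans_eq ?_
    congr 1
    have h1 : (b ^ (p / n)) ^ (-2 * s) = α ^ (-(r - 2)) * (2 * C * N) ^ (r - 2) := by
      rw [← Real.rpow_mul hb0.le, hb, Real.div_rpow hα.le (by positivity), div_eq_mul_inv,
        ← Real.rpow_neg (by positivity)]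
      congr 2 <;> (rw [hr]; ring)
    have h2 : α ^ (-r) = α ^ (-2 : ℝ) * α ^ (-(r - 2)) := by
      rw [← Real.rpow_add hα]; congr 1; ring
    rw [h1, h2, ← hHdef]; ring
  have hsmall : ∀ α, 0 < α → distributionFunction f α ≤ ENNReal.ofReal (W ^ q * α ^ (-q)) :=
    fun α hα => distributionFunction_le_of_weakLpNorm_lt_top hq0 hW hα
  have hcake : ∀ α₀, 0 < α₀ → N ^ p ≤ p * (W ^ q * (α₀ ^ (p - q) / (p - q)) +
      4 * (2 * C * N) ^ (r - 2) * H ^ 2 * (α₀ ^ (p - r) / (r - p))) := by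
    intro α₀ hα₀
    have := lintegral_rpow_norm_le_of_distributionFunction_le hf.1.aestronglyMeasurable hp hqp hpr
      hα₀ (A := W ^ q) (B := 4 * (2 * C * N) ^ (r - 2) * H ^ 2) (by positivity) (by positivity)
      hsmall fun α hα => hlarge α (hα₀.trans_le hα)
    rw [hNp] at this
    refine (ENNReal.ofReal_le_ofReal_iff ?_).1 this
    positivity
  -- if `W = 0`, then `f` vanishes almost everywhere
  have hWpos : 0 < W := by
    refine hW_nonneg.lt_of_ne fun hW0 => hN0.ne' ?_
    have hz := lintegral_rpow_norm_le_of_distributionFunction_le hf.1.aestronglyMeasurable hp hqp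
      hpr one_pos (A := 0) (B := 0) le_rfl le_rfl
      (fun α hα => by simpa [← hW0, Real.zero_rpow hq0.ne'] using hsmall α hα)
      (fun α hα => by simpa [← hW0, Real.zero_rpow hq0.ne'] using hsmall α (one_pos.trans_le hα))
    rw [hNp] at hz
    simp only [zero_mul, add_zero, mul_zero, ENNReal.ofReal_zero, nonpos_iff_eq_zero,
      ENNReal.ofReal_eq_zero] at hz
    exact absurd hz (not_le.2 (by positivity))
  have hreal := rpow_le_of_layer_cake_bound hq0 hqp hpr (by positivity : 0 < 2 * C) hN0 hWpos hcake
  rw [← hL, ← ha] at hreal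
  have hfinal : N ≤ L ^ (1 / (a + 2)) * W ^ (a / (a + 2)) * H ^ (2 / (a + 2)) := by
    have hH0 : 0 ≤ H := ENNReal.toReal_nonneg
    calc N = (N ^ (a + 2)) ^ (1 / (a + 2)) := by
          rw [← Real.rpow_mul hN0.le, mul_one_div_cancel (by positivity), Real.rpow_one]
      _ ≤ (L * W ^ a * H ^ 2) ^ (1 / (a + 2)) := by gcongr
      _ = _ := by
          rw [Real.mul_rpow (by positivity) (by positivity),
            Real.mul_rpow hL0 (by positivity), ← Real.rpow_mul hWpos.le, ← Real.rpow_two,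
            ← Real.rpow_mul hH0, mul_one_div, mul_one_div]
  rw [hθ, hN', ← ENNReal.ofReal_toReal hW.ne, ← ENNReal.ofReal_toReal hH.ne, ← hWdef, ← hHdef,
    ENNReal.ofReal_rpow_of_nonneg hWpos.le (by positivity),
    ENNReal.ofReal_rpow_of_nonneg ENNReal.toReal_nonneg (by positivity), ← ENNReal.ofReal,
    ← ENNReal.ofReal_mul (by positivity), ← ENNReal.ofReal_mul (by positivity)]
  exact ENNReal.ofReal_le_ofReal hfinal

end GagliardoNirenberg

theorem theorem7p1 :
    (∀ (n : ℕ) (p q s : ℝ), 1 ≤ n → 1 ≤ q → q < p → 0 ≤ s →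
      (n : ℝ) * (1 / 2 - 1 / p) < s →
      ∃ θ : ℝ, 0 < θ ∧ θ < 1 ∧ 1 / p = θ / q + (1 - θ) * (1 / 2 - s / (n : ℝ)) ∧
        ∃ c : ℝ≥0, ∀ (f : EuclideanSpace ℝ (Fin n) → ℂ)
          (T : 𝓢'(EuclideanSpace ℝ (Fin n), ℂ)),
          GagliardoNirenberg.IsGivenBy T f →
          GagliardoNirenberg.MemWeakLp f q →
          GagliardoNirenberg.MemHomSobolev s T →
          MemLp f (ENNReal.ofReal p) volume ∧
          eLpNorm f (ENNReal.ofReal p) volume ≤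
            (c : ℝ≥0∞) * GagliardoNirenberg.weakLpNorm f q ^ θ *
              GagliardoNirenberg.homSobolevNorm s T ^ (1 - θ)) ∧
    (∃ c : ℝ≥0, ∀ (f : EuclideanSpace ℝ (Fin 2) → ℂ)
        (T : 𝓢'(EuclideanSpace ℝ (Fin 2), ℂ)),
        GagliardoNirenberg.IsGivenBy T f →
        GagliardoNirenberg.MemWeakLp f 2 →
        GagliardoNirenberg.MemHomSobolev 1 T →
        MemLp f 4 volume ∧
        eLpNorm f 4 volume ≤
          (c : ℝ≥0∞) * GagliardoNirenberg.weakLpNorm f 2 ^ (1 / 2 : ℝ) *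
            GagliardoNirenberg.homSobolevNorm 1 T ^ (1 / 2 : ℝ)) := by
  refine ⟨fun n p q s hn hq hqp hs hsp =>
    GagliardoNirenberg.exists_eLpNorm_le hn hq hqp hs hsp, ?_⟩
  obtain ⟨θ, -, -, hθ, c, hc⟩ := GagliardoNirenberg.exists_eLpNorm_le (n := 2) (p := 4) (q := 2)
    (s := 1) one_le_two one_le_two (by norm_num) zero_le_one (by norm_num)
  -- here `1 / 2 - s / n = 0`, so the scaling relation reads `1 / 4 = θ / 2`
  have hθ' : θ = 1 / 2 := by norm_num at hθ; linarith
  rw [hθ', show (1 : ℝ) - 1 / 2 = 1 / 2 by norm_num, ENNReal.ofReal_ofNat] at hc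
  exact ⟨c, hc⟩
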